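/- Let $K$ be a field. An $O$-sequence is a function $H:\mathbb Z_{\ge 0}\to\mathbb Z_{\ge 0}$ of the form $H(t)=\dim_K R_t-\dim_K I_t$, where $I$ is a homogeneous ideal of a standard graded polynomial ring $R=K[x_1,\dots,x_p]$ in some number $p\ge 0$ of variables. A finite $O$-sequence of multiplicity $d$ is an $O$-sequence $(a_0,a_1,\dots,a_s,0,0,\dots)$ with $a_s\neq 0$ and $a_0+\dots+a_s=d$. For $d\geq 1$ let $O_d$ be the number of finite $O$-sequences of multiplicity $d$, and let $A_d$ be the number of those whose last non-zero value $a_s$ is strictly greater than $1$. Then the following hold. 1. For every $d\ge 3$ one has $1<\frac{O_d}{O_{d-1}}\le 2$, and $\frac{O_d}{O_{d-1}}=2$ if and only if $d=3$. In particular, $1<\frac{O_d}{O_{d-1}}<2$ for every $d\ge 4$. 2. The sequence $(O_d/O_{d-1})_d$ converges to a real number $b$ if and only if the sequence $(A_d/O_{d-1})_d$ converges to a real number $\ell$. In this case $b=1+\ell$; moreover, $b>1$ if and only if $\ell>0$. 3. If $(O_d/O_{d-1})_d$ converges to a real number $b$, then $b\le\frac{1+\sqrt5}{2}$ and, equivalently,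 $\ell\le\left(\frac{1+\sqrt5}{2}\right)^{-1}$, where $\ell$ is the limit of $(A_d/O_{d-1})_d$. 4. For every $d\ge 4$, $$\frac{A_d}{O_{d-1}}\le\frac{A_{d-1}}{O_{d-2}}+\frac{A_{d-2}}{O_{d-3}}\qquad\text{and}\qquad \frac{O_d}{O_{d-1}}\le\frac{O_{d-1}}{O_{d-2}}+\frac{O_{d-2}}{O_{d-3}}.$$ -/

import Mathlib

open Filter Topology

namespace OSequence

attribute [local instance] MvPolynomial.gradedAlgebra

/-- The Hilbert function `t ↦ dim R_t - dim I_t` of (the quotient `R / I` by) an ideal `I` of the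
standard graded polynomial ring `R = K[x_1, …, x_p]`; here `R_t` is the space of homogeneous
polynomials of degree `t` and `I_t = R_t ∩ I`. Both are finite-dimensional and `I_t ⊆ R_t`, so the
subtraction does not truncate. -/
noncomputable def hilbertFunction (K : Type*) [Field K] {p : ℕ}
    (I : Ideal (MvPolynomial (Fin p) K)) (t : ℕ) : ℕ :=
  Module.finrank K ↥(MvPolynomial.homogeneousSubmodule (Fin p) K t) -
    Module.finrank K
      ↥(MvPolynomial.homogeneousSubmodule (Fin p) K t ⊓ Submodule.restrictScalars K I)

/-- `H` is an O-sequence (over `K`): it is the Hilbert function of `K[x_1, …, x_p] / I` for some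
number of variables `p` and some homogeneous ideal `I`. -/
def IsOSequence (K : Type*) [Field K] (H : ℕ → ℕ) : Prop :=
  ∃ (p : ℕ) (I : Ideal (MvPolynomial (Fin p) K)),
    I.IsHomogeneous (MvPolynomial.homogeneousSubmodule (Fin p) K) ∧
      ∀ t, H t = hilbertFunction K I t

/-- `H = (a_0, …, a_s)`, `a_s ≠ 0`, continued by zero, is a finite O-sequence with socle
degree `s` and multiplicity `a_0 + ⋯ + a_s = d`. -/
def IsFiniteOSequence (K : Type*) [Field K] (d s : ℕ) (H : ℕ → ℕ) : Prop :=
  IsOSequence K H ∧ H s ≠ 0 ∧ (∀ t, s < t → H t = 0) ∧ ∑ i ∈ Finset.range (s + 1), H i = d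

/-- `O_d`: the number of finite O-sequences of multiplicity `d`. -/
noncomputable def numO (K : Type*) [Field K] (d : ℕ) : ℕ :=
  Set.ncard {H : ℕ → ℕ | ∃ s, IsFiniteOSequence K d s H}

/-- `A_d`: the number of finite O-sequences of multiplicity `d` whose last non-zero value is
strictly greater than `1`. -/
noncomputable def numA (K : Type*) [Field K] (d : ℕ) : ℕ :=
  Set.ncard {H : ℕ → ℕ | ∃ s, IsFiniteOSequence K d s H ∧ 1 < H s}

end OSequence

/-!
Everything follows from three relations between the numbers `O_d` and `A_d`:

* `O_{d+1} = O_d + A_{d+1}` for `d ≥ 1` (`numO_succ`): appending a last entry `1` is a bijection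
  from the finite O-sequences of multiplicity `d` onto those of multiplicity `d + 1` that end in `1`;
* `A_d ≤ A_{d-1} + A_{d-2}` for `d ≥ 4` (`numA_add_four_le`): a last entry `≥ 3` may be lowered by
  one, and a last entry `2` may be dropped, the entry before it being `≥ 2` as well;
* `A_d ≤ O_{d-2}` for `d ≥ 3` (`numA_add_three_le`), by induction from the other two.

They give `O_d ≤ O_{d-1} + O_{d-2}`, hence `b ≤ 1 + 1 / b` for a limit `b` of the ratios, and they
reduce the rest to elementary estimates.

To see that these operations respect O-sequences, an ideal is replaced by its initial ideal: the
O-sequences are the functions that count, degree by degree, the monomials of a set of monomials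
closed under taking divisors (`isOSequence_iff`). For such sets, truncation and lowering a last
entry are obvious, and so is the only case of Macaulay's growth bound that is needed, namely that
after an entry `1` in positive degree only `0` or `1` can follow
(`IsMulticomplexCount.apply_succ_le_one`). Appending a `1` after degree `s` is the one operation
that may require a different set of monomials: the monomials have to be rearranged so that a power
`x_j ^ s` of a variable occurs, to which `x_j ^ (s + 1)` can then be added. The rearrangement is by
compressions, which shift exponents from a variable `x_i` to `x_j` within each set of monomials that
agree in degree and in the other variables (`exists_single_mem`); this works over every field,
unlike a change of coordinates.
-/

namespace OSequence

attribute [local instance] MvPolynomial.gradedAlgebra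

/-! ### Initial ideals and multicomplexes -/

/-- The monomials of degree `t` in the set of monomials `Δ`; a monomial is encoded by its
exponent vector. -/
def slice {σ : Type*} (Δ : Set (σ →₀ ℕ)) (t : ℕ) : Set (σ →₀ ℕ) :=
  {m | m ∈ Δ ∧ m.degree = t}

/-- `H` counts, degree by degree, the monomials of a set of monomials in finitely many variables
that is closed under taking divisors. Such a set may be empty. -/
def IsMulticomplexCount (H : ℕ → ℕ) : Prop :=
  ∃ (p : ℕ) (Δ : Set (Fin p →₀ ℕ)), IsLowerSet Δ ∧ ∀ t, H t = (slice Δ t).ncard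

theorem slice_finite {σ : Type*} [Finite σ] (Δ : Set (σ →₀ ℕ)) (t : ℕ) : (slice Δ t).Finite :=
  (Finsupp.finite_of_degree_le t).subset fun _ hm => hm.2.le

theorem finrank_restrictSupport (K : Type*) [Field K] {σ : Type*} (s : Set (σ →₀ ℕ)) :
    Module.finrank K (MvPolynomial.restrictSupport K s) = s.ncard := by
  rw [Module.finrank_eq_nat_card_basis (MvPolynomial.basisRestrictSupport K s), Nat.card_coe_set_eq]

theorem homogeneousSubmodule_eq_restrictSupport (K : Type*) [Field K] (σ : Type*) (t : ℕ) :
    MvPolynomial.homogeneousSubmodule σ K t =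
      MvPolynomial.restrictSupport K (slice (Set.univ : Set (σ →₀ ℕ)) t) := by
  rw [MvPolynomial.homogeneousSubmodule_eq_finsupp_supported]
  simp [slice, MvPolynomial.restrictSupport]

/-- The dimension of a finite-dimensional space of polynomials is the number of leading monomials
of its non-zero elements. -/
theorem finrank_eq_ncard_leading {K : Type*} [Field K] {σ : Type*} (mo : MonomialOrder σ)
    (V : Submodule K (MvPolynomial σ K)) [FiniteDimensional K V] :
    Module.finrank K V = {m | ∃ f ∈ V, f ≠ 0 ∧ mo.degree f = m}.ncard := by
  classical
  set L := {m | ∃ f ∈ V, f ≠ 0 ∧ mo.degree f = m} with hL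
  choose f hfV hf0 hfd using fun m : L => m.2
  have hli : LinearIndependent K (fun m : L => (⟨f m, hfV m⟩ : V)) := by
    rw [linearIndependent_iff']
    intro s g hg
    by_contra! hne
    obtain ⟨i, his, hi⟩ := hne
    -- in a vanishing combination the largest leading monomial cannot cancel
    obtain ⟨m, hm, hmax⟩ := Finset.exists_max_image (s.filter fun m => g m ≠ 0)
      (fun m => mo.toSyn (m : σ →₀ ℕ)) ⟨i, by simp [his, hi]⟩
    rw [Finset.mem_filter] at hm
    have h1 := congrArg (fun v : V => (v : MvPolynomial σ K).coeff (m : σ →₀ ℕ)) hg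
    simp only [Submodule.coe_sum, Submodule.coe_smul, MvPolynomial.coeff_sum,
      MvPolynomial.coeff_smul, ZeroMemClass.coe_zero, MvPolynomial.coeff_zero] at h1
    rw [Finset.sum_eq_single m] at h1
    · have h2 : (f m).coeff (m : σ →₀ ℕ) ≠ 0 := by
        have := mo.coeff_degree_ne_zero_iff.2 (hf0 m)
        rwa [hfd m] at this
      exact (mul_ne_zero hm.2 h2) (by simpa using h1)
    · intro j hj hjm
      by_cases hgj : g j = 0
      · simp [hgj]
      · have hle := hmax j (by simp [hj, hgj])
        have hlt : mo.toSyn (j : σ →₀ ℕ) < mo.toSyn (m : σ →₀ ℕ) :=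
          lt_of_le_of_ne hle fun h => hjm (Subtype.ext (mo.toSyn.injective h))
        rw [mo.coeff_eq_zero_of_lt (by rw [hfd j]; exact hlt), smul_zero]
    · exact fun h => absurd hm.1 h
  have hfin : Finite L := hli.finite
  have hLfin : L.Finite := hfin
  let _ : Fintype L := Fintype.ofFinite L
  apply le_antisymm
  · -- an element of `V` is determined by its coefficients at the monomials of `L`
    let φ : V →ₗ[K] (L → K) :=
      { toFun := fun v m => (v : MvPolynomial σ K).coeff (m : σ →₀ ℕ)
        map_add' := fun u v => by ext; simp
        map_smul' := fun c v => by ext; simp }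
    have hφ : Function.Injective φ := by
      rw [injective_iff_map_eq_zero]
      intro v hv
      by_contra hv0
      have hv1 : (v : MvPolynomial σ K) ≠ 0 := fun h => hv0 (Subtype.ext h)
      have := congrFun hv ⟨mo.degree (v : MvPolynomial σ K), v, v.2, hv1, rfl⟩
      exact mo.coeff_degree_ne_zero_iff.2 hv1 this
    have := LinearMap.finrank_le_finrank_of_injective hφ
    rwa [Module.finrank_fintype_fun_eq_card, ← Nat.card_eq_fintype_card,
      Nat.card_coe_set_eq] at this
  · have := hli.fintype_card_le_finrank
    rwa [← Nat.card_eq_fintype_card, Nat.card_coe_set_eq] at this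

/-- The standard monomials of `I`, i.e. those that are not the leading monomial of an element of
`I`, are counted by the Hilbert function of `R / I`. -/
theorem hilbertFunction_eq_ncard_slice {K : Type*} [Field K] {p : ℕ}
    (I : Ideal (MvPolynomial (Fin p) K))
    (hI : I.IsHomogeneous (MvPolynomial.homogeneousSubmodule (Fin p) K)) (t : ℕ) :
    hilbertFunction K I t =
      (slice {m | ¬ ∃ f ∈ I, f ≠ 0 ∧ MonomialOrder.lex.degree f = m} t).ncard := by
  classical
  set lead := {m | ∃ f ∈ I, f ≠ 0 ∧ MonomialOrder.lex.degree f = m} with hlead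
  have : FiniteDimensional K (MvPolynomial.homogeneousSubmodule (Fin p) K t) :=
    Module.Finite.iff_fg.2 (MvPolynomial.homogeneousSubmodule_fg _ _ t)
  have : FiniteDimensional K ↥(MvPolynomial.homogeneousSubmodule (Fin p) K t ⊓
      Submodule.restrictScalars K I) := Submodule.finiteDimensional_inf_left _ _
  have hdeg : {m | ∃ f ∈ MvPolynomial.homogeneousSubmodule (Fin p) K t ⊓
      Submodule.restrictScalars K I, f ≠ 0 ∧ MonomialOrder.lex.degree f = m} = slice lead t := by
    ext m
    constructor
    · rintro ⟨f, ⟨hft, hfI⟩, hf0, rfl⟩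
      refine ⟨⟨f, hfI, hf0, rfl⟩, ?_⟩
      by_contra hne
      exact MonomialOrder.lex.coeff_degree_ne_zero_iff.2 hf0
        (MvPolynomial.IsHomogeneous.coeff_eq_zero hft hne)
    · rintro ⟨⟨f, hfI, hf0, rfl⟩, ht⟩
      -- the component of `f` in the degree of its leading monomial has the same leading monomial
      have hc : (MvPolynomial.homogeneousComponent t f).coeff (MonomialOrder.lex.degree f) ≠ 0 := by
        rw [MvPolynomial.coeff_homogeneousComponent, if_pos ht]
        exact MonomialOrder.lex.coeff_degree_ne_zero_iff.2 hf0
      have hg0 : MvPolynomial.homogeneousComponent t f ≠ 0 := fun h => hc (by rw [h]; simp)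
      refine ⟨MvPolynomial.homogeneousComponent t f,
        ⟨MvPolynomial.homogeneousComponent_isHomogeneous t f, ?_⟩, hg0, ?_⟩
      · exact MvPolynomial.homogeneousComponent_mem_of_mem hI hfI t
      · apply MonomialOrder.lex.toSyn.injective
        apply le_antisymm
        · rw [MonomialOrder.degree_le_iff]
          intro b hb
          apply MonomialOrder.le_degree
          rw [MvPolynomial.mem_support_iff, MvPolynomial.coeff_homogeneousComponent] at hb
          rw [MvPolynomial.mem_support_iff]
          exact fun h => hb (by simp [h])
        · exact MonomialOrder.le_degree (MvPolynomial.mem_support_iff.2 hc)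
  rw [hilbertFunction, finrank_eq_ncard_leading MonomialOrder.lex (_ ⊓ _), hdeg,
    homogeneousSubmodule_eq_restrictSupport, finrank_restrictSupport]
  have hsub : slice lead t ⊆ slice Set.univ t := fun m hm => ⟨trivial, hm.2⟩
  rw [← Set.ncard_sdiff hsub (slice_finite _ _)]
  congr 1
  ext m
  change _ ∧ ¬ (m ∈ lead ∧ _) ↔ m ∉ lead ∧ _
  simp only [slice, Set.mem_ofPred_eq, Set.mem_univ, true_and]
  tauto

/-- The polynomials supported outside a divisor-closed set of monomials form an ideal, whose
Hilbert function counts that set. -/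
theorem hilbertFunction_restrictSupportIdeal (K : Type*) [Field K] {p : ℕ}
    (Δ : Set (Fin p →₀ ℕ)) (hΔ : IsLowerSet Δ) (t : ℕ) :
    hilbertFunction K (MvPolynomial.restrictSupportIdeal (R := K) Δᶜ hΔ.compl) t =
      (slice Δ t).ncard := by
  have h : MvPolynomial.homogeneousSubmodule (Fin p) K t ⊓ Submodule.restrictScalars K
      (MvPolynomial.restrictSupportIdeal (R := K) Δᶜ hΔ.compl) =
      MvPolynomial.restrictSupport K (slice Δᶜ t) := by
    rw [homogeneousSubmodule_eq_restrictSupport]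
    ext f
    simp only [Submodule.mem_inf, MvPolynomial.mem_restrictSupport_iff,
      Submodule.restrictScalars_mem]
    change _ ∧ (f.support : Set _) ⊆ Δᶜ ↔ _
    rw [← Set.subset_inter_iff]
    have : slice Set.univ t ∩ Δᶜ = slice Δᶜ t := by
      ext m
      simp [slice, and_comm]
    rw [this]
  rw [hilbertFunction, h, homogeneousSubmodule_eq_restrictSupport, finrank_restrictSupport,
    finrank_restrictSupport]
  have hsub : slice Δᶜ t ⊆ slice Set.univ t := fun m hm => ⟨trivial, hm.2⟩
  rw [← Set.ncard_sdiff hsub (slice_finite _ _)]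
  congr 1
  ext m
  simp only [slice, Set.mem_sdiff, Set.mem_ofPred_eq, Set.mem_univ, true_and, Set.mem_compl_iff]
  tauto

theorem isHomogeneous_restrictSupportIdeal (K : Type*) [Field K] {p : ℕ}
    (s : Set (Fin p →₀ ℕ)) (hs : IsUpperSet s) :
    (MvPolynomial.restrictSupportIdeal (R := K) s hs).IsHomogeneous
      (MvPolynomial.homogeneousSubmodule (Fin p) K) := by
  intro t f hf
  have hc := MvPolynomial.decomposition.decompose'_apply f t
  change (DirectSum.decompose (MvPolynomial.homogeneousSubmodule (Fin p) K) f t :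
    MvPolynomial (Fin p) K) = _ at hc
  rw [hc]
  change ((MvPolynomial.homogeneousComponent t f).support : Set _) ⊆ s
  change (f.support : Set _) ⊆ s at hf
  intro m hm
  apply hf
  rw [Finset.mem_coe, MvPolynomial.mem_support_iff,
    MvPolynomial.coeff_homogeneousComponent] at hm
  rw [Finset.mem_coe, MvPolynomial.mem_support_iff]
  exact fun h => hm (by simp [h])

/-- Macaulay: O-sequences are the counting functions of multicomplexes, over any field. -/
theorem isOSequence_iff (K : Type*) [Field K] (H : ℕ → ℕ) :
    IsOSequence K H ↔ IsMulticomplexCount H := by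
  classical
  constructor
  · rintro ⟨p, I, hI, hH⟩
    refine ⟨p, _, ?_, fun t => (hH t).trans (hilbertFunction_eq_ncard_slice I hI t)⟩
    rintro m n hnm hm ⟨f, hfI, hf0, rfl⟩
    refine hm ⟨MvPolynomial.monomial (m - MonomialOrder.lex.degree f) 1 * f,
      I.mul_mem_left _ hfI, mul_ne_zero (by simp) hf0, ?_⟩
    rw [MonomialOrder.degree_mul (by simp) hf0, MonomialOrder.degree_monomial, if_neg one_ne_zero]
    exact tsub_add_cancel_of_le hnm
  · rintro ⟨p, Δ, hΔ, hH⟩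
    exact ⟨p, _, isHomogeneous_restrictSupportIdeal K _ hΔ.compl,
      fun t => (hH t).trans (hilbertFunction_restrictSupportIdeal K Δ hΔ t).symm⟩

/-! ### Compression of multicomplexes -/

theorem isLowerSet_of_add_single {σ : Type*} {Δ : Set (σ →₀ ℕ)}
    (h : ∀ m k, m + Finsupp.single k 1 ∈ Δ → m ∈ Δ) : IsLowerSet Δ := by
  have key : ∀ d m : σ →₀ ℕ, m + d ∈ Δ → m ∈ Δ := by
    intro d
    induction d using Finsupp.induction_linear with
    | zero => intro m hm; simpa using hm
    | add f g hf hg => intro m hm; exact hf m (hg _ (by rwa [add_assoc]))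
    | single k n =>
      induction n with
      | zero => intro m hm; simpa using hm
      | succ n ih =>
        intro m hm
        rw [Finsupp.single_add, ← add_assoc] at hm
        exact ih m (h _ _ hm)
  intro m n hnm hm
  exact key (m - n) n (by rwa [add_tsub_cancel_of_le hnm])

section Compression

variable {σ : Type*} (i j : σ)

/-- The monomial obtained from `m` by changing the exponent of the variable `i` to `a` and
adjusting the exponent of the variable `j` so that the degree stays the same; this is meant for
`a ≤ m i + m j`. -/
noncomputable def redistribute (m : σ →₀ ℕ) (a : ℕ) : σ →₀ ℕ :=
  (m.update i a).update j (m i + m j - a)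

variable {i j}

theorem redistribute_apply_left (hij : i ≠ j) (m : σ →₀ ℕ) (a : ℕ) :
    redistribute i j m a i = a := by
  classical simp [redistribute, Function.update_of_ne hij]

theorem redistribute_apply_right (m : σ →₀ ℕ) (a : ℕ) :
    redistribute i j m a j = m i + m j - a := by
  classical simp [redistribute]

theorem redistribute_apply_of_ne {k : σ} (hi : k ≠ i) (hj : k ≠ j) (m : σ →₀ ℕ) (a : ℕ) :
    redistribute i j m a k = m k := by
  classical simp [redistribute, Function.update_of_ne hi, Function.update_of_ne hj]

theorem redistribute_self (hij : i ≠ j) (m : σ →₀ ℕ) : redistribute i j m (m i) = m := by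
  ext k
  by_cases hj : k = j
  · subst hj; rw [redistribute_apply_right]; omega
  by_cases hi : k = i
  · subst hi; rw [redistribute_apply_left hij]
  rw [redistribute_apply_of_ne hi hj]

theorem redistribute_redistribute (hij : i ≠ j) (m : σ →₀ ℕ) {a : ℕ} (ha : a ≤ m i + m j) (b : ℕ) :
    redistribute i j (redistribute i j m a) b = redistribute i j m b := by
  ext k
  by_cases hj : k = j
  · subst hj
    rw [redistribute_apply_right, redistribute_apply_right, redistribute_apply_left hij,
      redistribute_apply_right]
    omega
  by_cases hi : k = i
  · subst hi; rw [redistribute_apply_left hij, redistribute_apply_left hij]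
  rw [redistribute_apply_of_ne hi hj, redistribute_apply_of_ne hi hj,
    redistribute_apply_of_ne hi hj]

theorem degree_redistribute (hij : i ≠ j) (m : σ →₀ ℕ) {a : ℕ} (ha : a ≤ m i + m j) :
    (redistribute i j m a).degree = m.degree := by
  have h : redistribute i j m a + Finsupp.single i (m i) + Finsupp.single j (m j) =
      m + Finsupp.single i a + Finsupp.single j (m i + m j - a) := by
    ext k
    simp only [Finsupp.add_apply]
    by_cases hj : k = j
    · subst hj
      rw [redistribute_apply_right, Finsupp.single_eq_of_ne hij.symm,
        Finsupp.single_eq_of_ne hij.symm, Finsupp.single_eq_same, Finsupp.single_eq_same]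
      omega
    by_cases hi : k = i
    · subst hi
      rw [redistribute_apply_left hij, Finsupp.single_eq_same, Finsupp.single_eq_same,
        Finsupp.single_eq_of_ne hj, Finsupp.single_eq_of_ne hj]
      omega
    rw [redistribute_apply_of_ne hi hj, Finsupp.single_eq_of_ne hi, Finsupp.single_eq_of_ne hj,
      Finsupp.single_eq_of_ne hi, Finsupp.single_eq_of_ne hj]
  have h' := congrArg Finsupp.degree h
  simp only [map_add, Finsupp.degree_single] at h'
  omega

variable (i j) in
/-- The exponents `a ≤ m i + m j` for which the redistribution of `m` lies in `Δ`. -/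
def fibre (Δ : Set (σ →₀ ℕ)) (m : σ →₀ ℕ) (a : ℕ) : Prop :=
  a ≤ m i + m j ∧ redistribute i j m a ∈ Δ

open Classical in
variable (i j) in
/-- The compression of `Δ` in the direction `i → j`: among the monomials that differ only by
moving exponents between the variables `i` and `j`, those of `Δ` are replaced by equally many with
the smallest exponents at `i`. -/
def compression (Δ : Set (σ →₀ ℕ)) : Set (σ →₀ ℕ) :=
  {m | m i < Nat.count (fibre i j Δ m) (m i + m j + 1)}

open Classical in
theorem mem_compression {Δ : Set (σ →₀ ℕ)} {m : σ →₀ ℕ} :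
    m ∈ compression i j Δ ↔ m i < Nat.count (fibre i j Δ m) (m i + m j + 1) :=
  Iff.rfl

theorem redistribute_sum (hij : i ≠ j) (m : σ →₀ ℕ) {a : ℕ} (ha : a ≤ m i + m j) :
    redistribute i j m a i + redistribute i j m a j = m i + m j := by
  rw [redistribute_apply_left hij, redistribute_apply_right]
  omega

theorem fibre_redistribute (hij : i ≠ j) (Δ : Set (σ →₀ ℕ)) (m : σ →₀ ℕ) {a : ℕ}
    (ha : a ≤ m i + m j) : fibre i j Δ (redistribute i j m a) = fibre i j Δ m := by
  funext b
  rw [fibre, fibre, redistribute_sum hij m ha, redistribute_redistribute hij m ha]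

theorem fibre_self (hij : i ≠ j) {Δ : Set (σ →₀ ℕ)} {m : σ →₀ ℕ} (hm : m ∈ Δ) :
    fibre i j Δ m (m i) :=
  ⟨Nat.le_add_right _ _, by rwa [redistribute_self hij]⟩

open Classical in
theorem ncard_slice_compression (hij : i ≠ j) (Δ : Set (σ →₀ ℕ)) (t : ℕ) :
    (slice (compression i j Δ) t).ncard = (slice Δ t).ncard := by
  symm
  -- within a fibre, the `k`-th exponent that occurs in `Δ` is moved to `k`
  refine Set.BijOn.ncard_eq
    (f := fun m => redistribute i j m (Nat.count (fibre i j Δ m) (m i)))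
    (Set.InvOn.bijOn (f' := fun m => redistribute i j m (Nat.nth (fibre i j Δ m) (m i)))
      ⟨?_, ?_⟩ ?_ ?_)
  · rintro m ⟨hm, -⟩
    have hle : Nat.count (fibre i j Δ m) (m i) ≤ m i + m j :=
      (Nat.count_le _).trans (Nat.le_add_right _ _)
    simp only
    rw [fibre_redistribute hij Δ m hle, redistribute_apply_left hij,
      Nat.nth_count (fibre_self hij hm), redistribute_redistribute hij m hle,
      redistribute_self hij]
  · rintro m ⟨hm, -⟩
    have hle := Nat.lt_succ_iff.1 (Nat.nth_lt_of_lt_count hm)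
    simp only
    rw [fibre_redistribute hij Δ m hle, redistribute_apply_left hij,
      Nat.count_nth fun hf => hm.trans_le (Nat.count_le_card hf _),
      redistribute_redistribute hij m hle, redistribute_self hij]
  · rintro m ⟨hm, hd⟩
    have hle : Nat.count (fibre i j Δ m) (m i) ≤ m i + m j :=
      (Nat.count_le _).trans (Nat.le_add_right _ _)
    refine ⟨?_, (degree_redistribute hij m hle).trans hd⟩
    simp only
    rw [mem_compression]
    rw [redistribute_sum hij m hle, fibre_redistribute hij Δ m hle, redistribute_apply_left hij]
    exact Nat.count_strict_mono (fibre_self hij hm) (by omega)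
  · rintro m ⟨hm, hd⟩
    have hle := Nat.lt_succ_iff.1 (Nat.nth_lt_of_lt_count hm)
    refine ⟨?_, (degree_redistribute hij m hle).trans hd⟩
    exact (Nat.nth_mem (p := fibre i j Δ m) _
      fun hf => hm.trans_le (Nat.count_le_card hf _)).2

/-- Macaulay's growth bound for monomials in two variables: the shadow of a set of `k` monomials of
degree `n` contains at least `min k n` monomials of degree `n - 1`. -/
theorem count_le_count_shadow (P Q : ℕ → Prop) [DecidablePred P] [DecidablePred Q] (n : ℕ)
    (h₀ : ∀ a < n, P a → Q a) (h₁ : ∀ a < n, P (a + 1) → Q a) :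
    Nat.count P (n + 1) ≤ Nat.count Q n ∨ Nat.count Q n = n := by
  induction n with
  | zero => right; simp
  | succ n ih =>
    have ih := ih (fun a ha => h₀ a (by omega)) (fun a ha => h₁ a (by omega))
    by_cases hQ : Q n
    · rw [Nat.count_succ, Nat.count_succ Q, if_pos hQ]
      have : (if P (n + 1) then 1 else 0) ≤ 1 := by split_ifs <;> simp
      omega
    · left
      rw [Nat.count_succ, Nat.count_succ, Nat.count_succ Q, if_neg hQ,
        if_neg fun h => hQ (h₀ n (by omega) h), if_neg fun h => hQ (h₁ n (by omega) h)]
      exact Nat.count_mono_left fun k hk => h₀ k (by omega)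

theorem redistribute_le_redistribute (hij : i ≠ j) {m n : σ →₀ ℕ}
    (h : ∀ l, l ≠ i → l ≠ j → m l ≤ n l) {a b : ℕ} (hab : a ≤ b)
    (hab' : m i + m j - a ≤ n i + n j - b) :
    redistribute i j m a ≤ redistribute i j n b := by
  intro l
  by_cases hl : l = j
  · subst hl; rwa [redistribute_apply_right, redistribute_apply_right]
  by_cases hl' : l = i
  · subst hl'; rwa [redistribute_apply_left hij, redistribute_apply_left hij]
  rw [redistribute_apply_of_ne hl' hl, redistribute_apply_of_ne hl' hl]
  exact h l hl' hl

open Classical in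
/-- Multiplying by `i` or `j` raises the degree within the two variables, and the initial segment of
exponents one degree lower is long enough by `count_le_count_shadow`; multiplying by another
variable can only shrink the fibre. -/
theorem isLowerSet_compression (hij : i ≠ j) {Δ : Set (σ →₀ ℕ)} (hΔ : IsLowerSet Δ) :
    IsLowerSet (compression i j Δ) := by
  refine isLowerSet_of_add_single fun m k hm => ?_
  rw [mem_compression] at hm ⊢
  by_cases hk : k = i ∨ k = j
  · set n := m + Finsupp.single k 1 with hn
    have hle : m ≤ n := le_self_add
    have hsum : n i + n j = m i + m j + 1 := by
      rw [hn, Finsupp.add_apply, Finsupp.add_apply]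
      rcases hk with rfl | rfl
      · rw [Finsupp.single_eq_same, Finsupp.single_eq_of_ne hij.symm]; omega
      · rw [Finsupp.single_eq_same, Finsupp.single_eq_of_ne hij]; omega
    have hshadow := count_le_count_shadow (fibre i j Δ n) (fibre i j Δ m) (m i + m j + 1)
      (fun a ha h => ⟨by omega, hΔ (redistribute_le_redistribute hij (fun l _ _ => hle l) le_rfl
        (by omega)) h.2⟩)
      (fun a ha h => ⟨by omega, hΔ (redistribute_le_redistribute hij (fun l _ _ => hle l)
        (Nat.le_succ a) (by omega)) h.2⟩)
    rw [hsum] at hm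
    have := hle i
    omega
  · push Not at hk
    have hi : (m + Finsupp.single k 1 : σ →₀ ℕ) i = m i := by
      rw [Finsupp.add_apply, Finsupp.single_eq_of_ne hk.1.symm, add_zero]
    have hj : (m + Finsupp.single k 1 : σ →₀ ℕ) j = m j := by
      rw [Finsupp.add_apply, Finsupp.single_eq_of_ne hk.2.symm, add_zero]
    rw [hi, hj] at hm
    refine hm.trans_le (Nat.count_mono_left fun a _ ha => ?_)
    refine ⟨by simpa only [hi, hj] using ha.1, hΔ ?_ ha.2⟩
    have hle : m ≤ m + Finsupp.single k 1 := le_self_add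
    exact redistribute_le_redistribute hij (fun l _ _ => hle l) le_rfl (by rw [hi, hj])

open Classical in
/-- Compression `i → j` turns a monomial of `Δ` into one in which the variable `i` has been
replaced by `j`. -/
theorem redistribute_zero_mem_compression (hij : i ≠ j) {Δ : Set (σ →₀ ℕ)} {m : σ →₀ ℕ}
    (hm : m ∈ Δ) : redistribute i j m 0 ∈ compression i j Δ := by
  rw [mem_compression, redistribute_sum hij m (Nat.zero_le _),
    fibre_redistribute hij Δ m (Nat.zero_le _), redistribute_apply_left hij]
  have := Nat.count_strict_mono (fibre_self hij hm) (n := m i + m j + 1) (by omega)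
  omega

end Compression

/-- Compressing towards the variable `j` in all directions makes a power of `j` appear, without
changing the counting function. -/
theorem exists_single_mem {σ : Type*} [Fintype σ] (j : σ) {Δ : Set (σ →₀ ℕ)} (hΔ : IsLowerSet Δ)
    {m : σ →₀ ℕ} (hm : m ∈ Δ) :
    ∃ Δ' : Set (σ →₀ ℕ), IsLowerSet Δ' ∧ (∀ t, (slice Δ' t).ncard = (slice Δ t).ncard) ∧
      Finsupp.single j m.degree ∈ Δ' := by
  classical
  have key : ∀ T : Finset σ, j ∉ T → ∃ Δ' : Set (σ →₀ ℕ), IsLowerSet Δ' ∧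
      (∀ t, (slice Δ' t).ncard = (slice Δ t).ncard) ∧
      ∃ n ∈ Δ', n.degree = m.degree ∧ ∀ k ∈ T, n k = 0 := by
    intro T
    induction T using Finset.induction_on with
    | empty => exact fun _ => ⟨Δ, hΔ, fun _ => rfl, m, hm, rfl, by simp⟩
    | insert i T _ ih =>
      intro hj
      rw [Finset.mem_insert, not_or] at hj
      obtain ⟨Δ', hΔ', hc, n, hn, hd, h0⟩ := ih hj.2
      have hij : i ≠ j := fun h => hj.1 h.symm
      refine ⟨compression i j Δ', isLowerSet_compression hij hΔ',
        fun t => (ncard_slice_compression hij Δ' t).trans (hc t), redistribute i j n 0,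
        redistribute_zero_mem_compression hij hn,
        (degree_redistribute hij n (Nat.zero_le _)).trans hd, fun k hk => ?_⟩
      by_cases hki : k = i
      · rw [hki, redistribute_apply_left hij]
      · have hkT := (Finset.mem_insert.1 hk).resolve_left hki
        rw [redistribute_apply_of_ne hki fun h : k = j => hj.2 (h ▸ hkT), h0 k hkT]
  obtain ⟨Δ', hΔ', hc, n, hn, hd, h0⟩ := key (Finset.univ.erase j) (by simp)
  refine ⟨Δ', hΔ', hc, ?_⟩
  have hn' : n = Finsupp.single j (n j) := by
    ext k
    by_cases hk : k = j
    · rw [hk, Finsupp.single_eq_same]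
    · rw [h0 k (by simp [hk]), Finsupp.single_eq_of_ne hk]
  have : n j = m.degree := by
    rw [← hd]
    conv_rhs => rw [hn', Finsupp.degree_single]
  rwa [← this, ← hn']

/-! ### Operations on counting functions -/

theorem exists_eq_add_single {σ : Type*} {m : σ →₀ ℕ} {t : ℕ} (hm : m.degree = t + 1) :
    ∃ n k, m = n + Finsupp.single k 1 ∧ n.degree = t := by
  have h0 : m ≠ 0 := by
    rintro rfl
    simp at hm
  obtain ⟨k, hk⟩ := Finsupp.ne_iff.1 h0
  have hle : Finsupp.single k 1 ≤ m := Finsupp.single_le_iff.2 (Nat.one_le_iff_ne_zero.2 hk)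
  refine ⟨m - Finsupp.single k 1, k, (tsub_add_cancel_of_le hle).symm, ?_⟩
  have h := congrArg Finsupp.degree (tsub_add_cancel_of_le hle)
  rw [map_add, Finsupp.degree_single] at h
  omega

theorem ncard_slice_ne_zero_iff {σ : Type*} [Finite σ] {Δ : Set (σ →₀ ℕ)} {t : ℕ} :
    (slice Δ t).ncard ≠ 0 ↔ ∃ m ∈ Δ, m.degree = t := by
  rw [← Nat.pos_iff_ne_zero, Set.ncard_pos (slice_finite Δ t)]
  rfl

namespace IsMulticomplexCount

variable {H : ℕ → ℕ}

theorem apply_zero_le_one (h : IsMulticomplexCount H) : H 0 ≤ 1 := by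
  obtain ⟨p, Δ, -, hH⟩ := h
  rw [hH, ← Set.ncard_singleton (0 : Fin p →₀ ℕ)]
  exact Set.ncard_le_ncard fun m hm => (Finsupp.degree_eq_zero_iff m).1 hm.2

theorem ne_zero_of_le (h : IsMulticomplexCount H) {s t : ℕ} (hs : H s ≠ 0) (hts : t ≤ s) :
    H t ≠ 0 := by
  obtain ⟨p, Δ, hΔ, hH⟩ := h
  induction hts using Nat.decreasingInduction with
  | self => exact hs
  | of_succ k _ ih =>
    rw [hH, ncard_slice_ne_zero_iff] at ih ⊢
    obtain ⟨m, hm, hd⟩ := ih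
    obtain ⟨n, i, rfl, hn⟩ := exists_eq_add_single hd
    exact ⟨n, hΔ le_self_add hm, hn⟩

/-- The case `H t = 1` of Macaulay's growth bound. -/
theorem apply_succ_le_one (h : IsMulticomplexCount H) {t : ℕ} (ht : t ≠ 0) (h1 : H t = 1) :
    H (t + 1) ≤ 1 := by
  obtain ⟨p, Δ, hΔ, hH⟩ := h
  rw [hH, Set.ncard_eq_one] at h1
  obtain ⟨m, hm⟩ := h1
  have hmem : m ∈ slice Δ t := by rw [hm]; rfl
  have huniq : ∀ n ∈ Δ, n.degree = t → n = m := fun n hn hd => by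
    have : n ∈ slice Δ t := ⟨hn, hd⟩
    rwa [hm] at this
  obtain ⟨l, hl⟩ : ∃ l, m l ≠ 0 := by
    by_contra! h0
    apply ht
    rw [← hmem.2, (Finsupp.degree_eq_zero_iff m).2 (Finsupp.ext h0)]
  -- all monomials of degree `t + 1` are multiples of `m`, so `l` divides each of them, and
  -- division by `l` has to give `m`
  suffices hsub : slice Δ (t + 1) ⊆ {m + Finsupp.single l 1} by
    rw [hH]
    exact (Set.ncard_le_ncard hsub).trans_eq (Set.ncard_singleton _)
  intro n ⟨hn, hd⟩
  obtain ⟨n', k, rfl, hn'⟩ := exists_eq_add_single hd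
  have hn'm := huniq n' (hΔ le_self_add hn) hn'
  rw [hn'm] at hn hd ⊢
  have hle : Finsupp.single l 1 ≤ m + Finsupp.single k 1 :=
    (Finsupp.single_le_iff.2 (Nat.one_le_iff_ne_zero.2 hl)).trans le_self_add
  have hsub := tsub_add_cancel_of_le hle
  have hd' := congrArg Finsupp.degree hsub
  rw [map_add, hd, Finsupp.degree_single] at hd'
  have := huniq (m + Finsupp.single k 1 - Finsupp.single l 1) (hΔ tsub_le_self hn) (by omega)
  rw [this] at hsub
  exact hsub.symm

theorem truncate (h : IsMulticomplexCount H) (s : ℕ) :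
    IsMulticomplexCount fun t => if t ≤ s then H t else 0 := by
  obtain ⟨p, Δ, hΔ, hH⟩ := h
  refine ⟨p, {m | m ∈ Δ ∧ m.degree ≤ s},
    fun m n hnm hm => ⟨hΔ hnm hm.1, (Finsupp.degree_mono hnm).trans hm.2⟩, fun t => ?_⟩
  beta_reduce
  split_ifs with hts
  · rw [hH]
    congr 1
    ext m
    exact ⟨fun hm => ⟨⟨hm.1, hm.2.trans_le hts⟩, hm.2⟩, fun hm => ⟨hm.1.1, hm.2⟩⟩
  · symm
    by_contra hne
    obtain ⟨m, hm, hd⟩ := ncard_slice_ne_zero_iff.1 hne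
    exact hts (hd ▸ hm.2)

theorem update_sub_one (h : IsMulticomplexCount H) {s : ℕ} (hs : H s ≠ 0)
    (hz : ∀ t, s < t → H t = 0) : IsMulticomplexCount (Function.update H s (H s - 1)) := by
  obtain ⟨p, Δ, hΔ, hH⟩ := h
  rw [hH, ncard_slice_ne_zero_iff] at hs
  obtain ⟨m, hm, hd⟩ := hs
  refine ⟨p, Δ \ {m}, fun a b hba ha => ⟨hΔ hba ha.1, ?_⟩, fun t => ?_⟩
  · rintro rfl
    refine ha.2 (le_antisymm ?_ hba)
    have hle := Finsupp.degree_mono hba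
    have hdeg : a.degree = s := by
      by_contra hne
      exact ncard_slice_ne_zero_iff.2 ⟨a, ha.1, rfl⟩
        ((hH _).symm.trans (hz a.degree (by omega)))
    have hsum := congrArg Finsupp.degree (tsub_add_cancel_of_le hba)
    rw [map_add] at hsum
    have : a - b = 0 := (Finsupp.degree_eq_zero_iff _).1 (by omega)
    exact tsub_eq_zero_iff_le.1 this
  · by_cases hts : t = s
    · subst hts
      rw [Function.update_self, hH]
      have : slice (Δ \ {m}) t = slice Δ t \ {m} := by
        ext n
        change (_ ∧ _) ∧ _ ↔ (_ ∧ _) ∧ _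
        tauto
      rw [this, Set.ncard_sdiff_singleton_of_mem (show m ∈ slice Δ t from ⟨hm, hd⟩)]
    · rw [Function.update_of_ne hts, hH]
      congr 1
      ext n
      refine ⟨fun hn => ⟨⟨hn.1, ?_⟩, hn.2⟩, fun hn => ⟨hn.1.1, hn.2⟩⟩
      rintro rfl
      exact hts (hn.2.symm.trans hd)

/-- `(1, n, 0, 0, …)` counts the monomials of degree at most one in `n` variables. -/
theorem one_cons (n : ℕ) :
    IsMulticomplexCount fun t => if t = 0 then 1 else if t = 1 then n else 0 := by
  refine ⟨n, {m | m.degree ≤ 1}, fun m k hkm hm => (Finsupp.degree_mono hkm).trans hm,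
    fun t => ?_⟩
  beta_reduce
  split_ifs with h0 h1
  · subst h0
    have : slice {m : Fin n →₀ ℕ | m.degree ≤ 1} 0 = {0} := by
      ext m
      refine ⟨fun hm => (Finsupp.degree_eq_zero_iff m).1 hm.2, ?_⟩
      rintro rfl
      exact ⟨by simp, by simp⟩
    rw [this, Set.ncard_singleton]
  · subst h1
    have : slice {m : Fin n →₀ ℕ | m.degree ≤ 1} 1 = Set.range fun i => Finsupp.single i 1 := by
      ext m
      constructor
      · rintro ⟨-, hm⟩
        obtain ⟨m', k, rfl, hm'⟩ := exists_eq_add_single hm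
        rw [(Finsupp.degree_eq_zero_iff m').1 hm', zero_add]
        exact ⟨k, rfl⟩
      · rintro ⟨i, rfl⟩
        exact ⟨by simp, by simp⟩
    rw [this, Set.ncard_range_of_injective (Finsupp.single_left_injective one_ne_zero),
      Nat.card_fin]
  · symm
    by_contra hne
    obtain ⟨m, hm, hd⟩ := ncard_slice_ne_zero_iff.1 hne
    change m.degree ≤ 1 at hm
    omega

/-- A counting function that ends in degree `s` may be continued by a `1`. -/
theorem update_succ_one (h : IsMulticomplexCount H) {s : ℕ} (hs : H s ≠ 0)
    (hz : ∀ t, s < t → H t = 0) : IsMulticomplexCount (Function.update H (s + 1) 1) := by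
  by_cases hs0 : s = 0
  · subst hs0
    have h0 : H 0 = 1 := le_antisymm h.apply_zero_le_one (Nat.one_le_iff_ne_zero.2 hs)
    convert one_cons 1 using 1
    funext t
    rcases t with _ | _ | t
    · simpa using h0
    · simp
    · simpa [Function.update_of_ne] using hz (t + 2) (by omega)
  obtain ⟨p, Δ, hΔ, hH⟩ := h
  rw [hH, ncard_slice_ne_zero_iff] at hs
  obtain ⟨m, hm, hd⟩ := hs
  obtain ⟨j, -⟩ : ∃ j, m j ≠ 0 := by
    by_contra! h0
    apply hs0
    rw [← hd, (Finsupp.degree_eq_zero_iff m).2 (Finsupp.ext h0)]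
  obtain ⟨Δ', hΔ', hc, hj⟩ := exists_single_mem j hΔ hm
  rw [hd] at hj
  have hH' : ∀ t, H t = (slice Δ' t).ncard := fun t => (hH t).trans (hc t).symm
  have hdeg : ∀ n ∈ Δ', n.degree ≤ s := fun n hn => by
    by_contra! hlt
    exact ncard_slice_ne_zero_iff.2 ⟨n, hn, rfl⟩ ((hH' _).symm.trans (hz _ hlt))
  refine ⟨p, insert (Finsupp.single j (s + 1)) Δ', ?_, fun t => ?_⟩
  · refine isLowerSet_of_add_single fun n k hn => ?_
    right
    rcases hn with hn | hn
    · -- a proper divisor of `j ^ (s + 1)` divides `j ^ s`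
      have hk : k = j := by
        by_contra hkj
        have := DFunLike.congr_fun hn k
        rw [Finsupp.add_apply, Finsupp.single_eq_same, Finsupp.single_eq_of_ne hkj] at this
        omega
      rw [hk, Finsupp.single_add] at hn
      rwa [add_right_cancel hn]
    · exact hΔ' le_self_add hn
  · by_cases hts : t = s + 1
    · subst hts
      rw [Function.update_self]
      have : slice (insert (Finsupp.single j (s + 1)) Δ') (s + 1) = {Finsupp.single j (s + 1)} := by
        ext n
        constructor
        · rintro ⟨hn | hn, hd'⟩
          · exact hn
          · have := hdeg n hn
            omega
        · rintro rfl
          exact ⟨Or.inl rfl, Finsupp.degree_single _ _⟩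
      rw [this, Set.ncard_singleton]
    · rw [Function.update_of_ne hts, hH']
      congr 1
      ext n
      refine ⟨fun hn => ⟨Or.inr hn.1, hn.2⟩, ?_⟩
      rintro ⟨rfl | hn, hd'⟩
      · exact absurd (hd'.symm.trans (Finsupp.degree_single _ _)) hts
      · exact ⟨hn, hd'⟩

end IsMulticomplexCount

/-! ### Removing and appending last entries -/

/-- `H` is the counting function of a multicomplex with `d` monomials whose last non-zero value is
in degree `s`. -/
structure EndsAt (d s : ℕ) (H : ℕ → ℕ) : Prop where
  count : IsMulticomplexCount H
  ne_zero : H s ≠ 0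
  eq_zero : ∀ t, s < t → H t = 0
  sum_eq : ∑ i ∈ Finset.range (s + 1), H i = d

/-- The sequence without its last non-zero entry. This is what is meant for sequences without
internal zeros, for which the last non-zero entry is the one that is followed by a zero. -/
def dropLast (H : ℕ → ℕ) (t : ℕ) : ℕ := if H (t + 1) = 0 then 0 else H t

/-- The sequence with its last non-zero entry lowered by one; as for `dropLast`, internal zeros are
not allowed for. -/
def decLast (H : ℕ → ℕ) (t : ℕ) : ℕ := if H (t + 1) = 0 then H t - 1 else H t

theorem isFiniteOSequence_iff (K : Type*) [Field K] {d s : ℕ} {H : ℕ → ℕ} :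
    IsFiniteOSequence K d s H ↔ EndsAt d s H := by
  rw [IsFiniteOSequence, isOSequence_iff]
  exact ⟨fun h => ⟨h.1, h.2.1, h.2.2.1, h.2.2.2⟩, fun h => ⟨h.1, h.2, h.3, h.4⟩⟩

theorem endsAt_one_cons {n : ℕ} (hn : n ≠ 0) :
    EndsAt (n + 1) 1 fun t => if t = 0 then 1 else if t = 1 then n else 0 where
  count := .one_cons n
  ne_zero := by simpa
  eq_zero t ht := by rw [if_neg (by omega), if_neg (by omega)]
  sum_eq := by simp [Finset.sum_range_succ, add_comm]

namespace EndsAt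

variable {d d' s s' : ℕ} {H : ℕ → ℕ}

theorem unique (h : EndsAt d s H) (h' : EndsAt d' s' H) : s = s' := by
  apply le_antisymm
  · by_contra! hlt
    exact h.ne_zero (h'.eq_zero _ hlt)
  · by_contra! hlt
    exact h'.ne_zero (h.eq_zero _ hlt)

theorem apply_zero (h : EndsAt d s H) : H 0 = 1 :=
  le_antisymm h.count.apply_zero_le_one
    (Nat.one_le_iff_ne_zero.2 (h.count.ne_zero_of_le h.ne_zero (Nat.zero_le s)))

theorem add_le (h : EndsAt d s H) : s + H s ≤ d := by
  rw [← h.sum_eq, Finset.sum_range_succ]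
  have : ∑ _i ∈ Finset.range s, 1 ≤ ∑ i ∈ Finset.range s, H i :=
    Finset.sum_le_sum fun i hi => Nat.one_le_iff_ne_zero.2
      (h.count.ne_zero_of_le h.ne_zero (Finset.mem_range.1 hi).le)
  simpa using this

theorem apply_succ_eq_zero_iff (h : EndsAt d s H) {t : ℕ} : H (t + 1) = 0 ↔ s ≤ t := by
  constructor
  · intro h0
    by_contra! hlt
    exact h.count.ne_zero_of_le h.ne_zero hlt h0
  · exact fun hst => h.eq_zero _ (by omega)

theorem decLast_eq (h : EndsAt d s H) : decLast H = Function.update H s (H s - 1) := by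
  funext t
  rw [decLast]
  by_cases hts : t = s
  · rw [hts, Function.update_self, if_pos (h.apply_succ_eq_zero_iff.2 le_rfl)]
  · rw [Function.update_of_ne hts]
    split_ifs with h0
    · have := h.apply_succ_eq_zero_iff.1 h0
      rw [h.eq_zero t (by omega)]
    · rfl

theorem decLast_apply (h : EndsAt d s H) : decLast H s = H s - 1 := by
  rw [h.decLast_eq, Function.update_self]

protected theorem decLast (h : EndsAt (d + 1) s H) (hs : 1 < H s) : EndsAt d s (decLast H) where
  count := h.decLast_eq ▸ h.count.update_sub_one h.ne_zero h.eq_zero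
  ne_zero := by rw [h.decLast_apply]; omega
  eq_zero t ht := by rw [h.decLast_eq, Function.update_of_ne ht.ne', h.eq_zero t ht]
  sum_eq := by
    have h1 := h.sum_eq
    rw [Finset.sum_range_succ] at h1 ⊢
    rw [h.decLast_apply, h.decLast_eq, Finset.sum_congr rfl fun i hi =>
      Function.update_of_ne (Finset.mem_range.1 hi).ne _ _]
    omega

theorem dropLast_eq (h : EndsAt d (s + 1) H) :
    dropLast H = fun t => if t ≤ s then H t else 0 := by
  funext t
  rw [dropLast]
  by_cases hts : t ≤ s
  · rw [if_neg (by rw [h.apply_succ_eq_zero_iff]; omega), if_pos hts]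
  · rw [if_pos (by rw [h.apply_succ_eq_zero_iff]; omega), if_neg hts]

theorem dropLast_apply (h : EndsAt d (s + 1) H) : dropLast H s = H s := by
  rw [h.dropLast_eq]
  exact if_pos le_rfl

protected theorem dropLast (h : EndsAt (d + H (s + 1)) (s + 1) H) : EndsAt d s (dropLast H) where
  count := h.dropLast_eq ▸ h.count.truncate s
  ne_zero := by
    rw [h.dropLast_apply]
    exact h.count.ne_zero_of_le h.ne_zero (Nat.le_succ s)
  eq_zero t ht := by
    rw [h.dropLast_eq]
    exact if_neg (by omega)
  sum_eq := by
    have h1 := h.sum_eq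
    rw [Finset.sum_range_succ] at h1
    rw [h.dropLast_eq, Finset.sum_congr rfl fun i hi => if_pos (by
      have := Finset.mem_range.1 hi
      omega)]
    exact Nat.add_right_cancel h1

theorem append_one (h : EndsAt d s H) :
    EndsAt (d + 1) (s + 1) (Function.update H (s + 1) 1) where
  count := h.count.update_succ_one h.ne_zero h.eq_zero
  ne_zero := by simp
  eq_zero t ht := by rw [Function.update_of_ne ht.ne', h.eq_zero t (by omega)]
  sum_eq := by
    rw [Finset.sum_range_succ, Function.update_self, Finset.sum_congr rfl fun i hi =>
      Function.update_of_ne (Finset.mem_range.1 hi).ne _ _, h.sum_eq]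

theorem dropLast_append_one (h : EndsAt d s H) :
    dropLast (Function.update H (s + 1) 1) = H := by
  rw [h.append_one.dropLast_eq]
  funext t
  split_ifs with hts
  · rw [Function.update_of_ne (by omega)]
  · rw [h.eq_zero t (by omega)]

end EndsAt

theorem injOn_decLast (d : ℕ) :
    Set.InjOn decLast {H | ∃ s, EndsAt (d + 1) s H ∧ 1 < H s} := by
  rintro H ⟨s, h, hs⟩ G ⟨r, g, hr⟩ heq
  have hsr : s = r := (h.decLast hs).unique (d' := d) (heq ▸ g.decLast hr)
  subst hsr
  have h1 := h.decLast_apply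
  rw [heq, g.decLast_apply] at h1
  rw [h.decLast_eq, g.decLast_eq] at heq
  funext t
  by_cases hts : t = s
  · subst hts; omega
  · have := congrFun heq t
    rwa [Function.update_of_ne hts, Function.update_of_ne hts] at this

theorem injOn_dropLast (d c : ℕ) :
    Set.InjOn dropLast {H | ∃ s, EndsAt (d + c) (s + 1) H ∧ H (s + 1) = c} := by
  rintro H ⟨s, h, rfl⟩ G ⟨r, g, hr⟩ heq
  rw [← hr] at g
  have hsr : s = r := h.dropLast.unique (d' := d) (heq ▸ g.dropLast)
  subst hsr
  rw [h.dropLast_eq, g.dropLast_eq] at heq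
  funext t
  rcases lt_trichotomy t (s + 1) with hlt | rfl | hgt
  · have := congrFun heq t
    simpa only [if_pos (show t ≤ s by omega)] using this
  · exact hr.symm
  · rw [h.eq_zero t hgt, g.eq_zero t hgt]

theorem finite_endsAt (d : ℕ) : {H | ∃ s, EndsAt d s H}.Finite := by
  refine Set.Finite.of_finite_image (f := fun (H : ℕ → ℕ) (i : Fin d) => H i)
    (Set.Finite.subset (s := Set.univ.pi fun _ => Set.Iic d)
      (Set.Finite.pi fun _ => Set.finite_Iic d) ?_) ?_
  · rintro _ ⟨H, ⟨s, h⟩, rfl⟩ i -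
    by_cases his : (i : ℕ) ≤ s
    · refine le_trans ?_ h.sum_eq.le
      exact Finset.single_le_sum (f := H) (fun _ _ => Nat.zero_le _) (by simpa using by omega)
    · simp [h.eq_zero i (by omega)]
  · rintro H ⟨s, h⟩ G ⟨r, g⟩ heq
    funext t
    by_cases ht : t < d
    · exact congrFun heq ⟨t, ht⟩
    · have h1 := h.add_le
      have h2 := g.add_le
      have h3 := h.ne_zero
      have h4 := g.ne_zero
      rw [h.eq_zero t (by omega), g.eq_zero t (by omega)]

theorem finite_endsAt_one_lt (d : ℕ) : {H | ∃ s, EndsAt d s H ∧ 1 < H s}.Finite :=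
  (finite_endsAt d).subset fun _ ⟨s, h, _⟩ => ⟨s, h⟩

/-! ### Recursions for the numbers of O-sequences -/

section Counting

variable (K : Type*) [Field K]

theorem numO_eq (d : ℕ) : numO K d = {H | ∃ s, EndsAt d s H}.ncard := by
  simp only [numO, isFiniteOSequence_iff]

theorem numA_eq (d : ℕ) : numA K d = {H | ∃ s, EndsAt d s H ∧ 1 < H s}.ncard := by
  simp only [numA, isFiniteOSequence_iff]

theorem numO_one : numO K 1 = 1 := by
  rw [numO_eq, Set.ncard_eq_one]
  refine ⟨fun t => if t = 0 then 1 else 0, Set.Subset.antisymm ?_ ?_⟩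
  · rintro H ⟨s, h⟩
    have h1 := h.add_le
    have h2 := h.ne_zero
    funext t
    split_ifs with ht
    · rw [ht, h.apply_zero]
    · exact h.eq_zero t (by omega)
  · rintro _ rfl
    refine ⟨0, ?_, by simp, fun t ht => if_neg (by omega), by simp⟩
    simpa using IsMulticomplexCount.one_cons 0

theorem numA_two : numA K 2 = 0 := by
  rw [numA_eq, Set.ncard_eq_zero (finite_endsAt_one_lt 2)]
  refine Set.eq_empty_of_forall_notMem fun H ⟨s, h, hs⟩ => ?_
  have h1 := h.add_le
  obtain rfl : s = 0 := by omega
  have := h.apply_zero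
  omega

theorem numA_three : numA K 3 = 1 := by
  rw [numA_eq, Set.ncard_eq_one]
  refine ⟨fun t => if t = 0 then 1 else if t = 1 then 2 else 0, Set.Subset.antisymm ?_ ?_⟩
  · rintro H ⟨s, h, hs⟩
    have h1 := h.add_le
    have h0 := h.apply_zero
    have hs0 : s ≠ 0 := by
      rintro rfl
      omega
    obtain rfl : s = 1 := by omega
    funext t
    split_ifs with ht ht'
    · rw [ht, h0]
    · subst ht'
      omega
    · exact h.eq_zero t (by omega)
  · rintro _ rfl
    exact ⟨1, endsAt_one_cons two_ne_zero, by simp⟩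

theorem numA_pos {d : ℕ} (hd : 3 ≤ d) : 0 < numA K d := by
  obtain ⟨n, rfl⟩ := Nat.exists_eq_add_of_le' (show 1 ≤ d by omega)
  rw [numA_eq, Set.ncard_pos (finite_endsAt_one_lt _)]
  exact ⟨_, 1, endsAt_one_cons (n := n) (by omega), by simpa using by omega⟩

/-- Appending a last entry `1` is a bijection onto the finite O-sequences that end in `1`. -/
theorem numO_succ {d : ℕ} (hd : 1 ≤ d) : numO K (d + 1) = numO K d + numA K (d + 1) := by
  have hsplit : {H | ∃ s, EndsAt (d + 1) s H} =
      {H | ∃ s, EndsAt (d + 1) (s + 1) H ∧ H (s + 1) = 1} ∪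
        {H | ∃ s, EndsAt (d + 1) s H ∧ 1 < H s} := by
    ext H
    constructor
    · rintro ⟨s, h⟩
      by_cases h1 : 1 < H s
      · exact Or.inr ⟨s, h, h1⟩
      · have h2 := h.ne_zero
        rcases s with _ | s
        · have := h.sum_eq
          simp only [zero_add, Finset.range_one, Finset.sum_singleton] at this
          omega
        · exact Or.inl ⟨s, h, by omega⟩
    · rintro (⟨s, h, -⟩ | ⟨s, h, -⟩)
      exacts [⟨_, h⟩, ⟨_, h⟩]
  have hbij : Set.BijOn dropLast {H | ∃ s, EndsAt (d + 1) (s + 1) H ∧ H (s + 1) = 1}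
      {H | ∃ s, EndsAt d s H} := by
    refine ⟨?_, injOn_dropLast d 1, ?_⟩
    · rintro H ⟨s, h, h1⟩
      exact ⟨s, EndsAt.dropLast (by rwa [h1])⟩
    · rintro H ⟨s, h⟩
      exact ⟨_, ⟨s, h.append_one, by simp⟩, h.dropLast_append_one⟩
  rw [numO_eq, numO_eq, numA_eq, ← hbij.ncard_eq, hsplit]
  refine Set.ncard_union_eq ?_ ((finite_endsAt (d + 1)).subset fun _ ⟨_, h, _⟩ => ⟨_, h⟩)
    (finite_endsAt_one_lt _)
  rw [Set.disjoint_left]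
  rintro H ⟨s, h, h1⟩ ⟨r, h', hr⟩
  rw [← h.unique h', h1] at hr
  omega

/-- A last entry of at least `3` is lowered by one, a last entry `2` is removed; in the second
case the entry before it is again at least `2`. -/
theorem numA_add_four_le (n : ℕ) : numA K (n + 4) ≤ numA K (n + 3) + numA K (n + 2) := by
  have hsplit : {H | ∃ s, EndsAt (n + 4) s H ∧ 1 < H s} ⊆
      {H | ∃ s, EndsAt (n + 4) s H ∧ 2 < H s} ∪
        {H | ∃ s, EndsAt (n + 4) (s + 1) H ∧ H (s + 1) = 2} := by
    rintro H ⟨s, h, hs⟩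
    by_cases h2 : 2 < H s
    · exact Or.inl ⟨s, h, h2⟩
    · rcases s with _ | s
      · have := h.apply_zero
        omega
      · exact Or.inr ⟨s, h, by omega⟩
  rw [numA_eq, numA_eq, numA_eq]
  refine (Set.ncard_le_ncard hsplit (Set.Finite.union ?_ ?_)).trans
    ((Set.ncard_union_le _ _).trans (add_le_add ?_ ?_))
  · exact (finite_endsAt (n + 4)).subset fun _ ⟨_, h, _⟩ => ⟨_, h⟩
  · exact (finite_endsAt (n + 4)).subset fun _ ⟨_, h, _⟩ => ⟨_, h⟩
  · refine Set.ncard_le_ncard_of_injOn decLast ?_ ((injOn_decLast (n + 3)).mono ?_)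
      (finite_endsAt_one_lt _)
    all_goals rintro H ⟨s, h, hs⟩
    on_goal 2 => exact ⟨s, h, by omega⟩
    exact ⟨s, h.decLast (by omega), by rw [h.decLast_apply]; omega⟩
  · refine Set.ncard_le_ncard_of_injOn dropLast ?_ (injOn_dropLast (n + 2) 2)
      (finite_endsAt_one_lt _)
    rintro H ⟨s, h, hs⟩
    refine ⟨s, EndsAt.dropLast (by rwa [hs]), ?_⟩
    rw [h.dropLast_apply]
    have h0 := h.count.ne_zero_of_le h.ne_zero (Nat.le_succ s)
    by_contra hle
    by_cases hs0 : s = 0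
    · -- `(1, 2)` has multiplicity `3` only
      subst hs0
      have h1 := h.sum_eq
      rw [Finset.sum_range_succ, Finset.sum_range_one, hs] at h1
      omega
    · have := h.count.apply_succ_le_one hs0 (by omega)
      omega

theorem numA_add_three_le (n : ℕ) : numA K (n + 3) ≤ numO K (n + 1) := by
  induction n with
  | zero => rw [numA_three, numO_one]
  | succ n ih =>
    have h1 := numA_add_four_le K n
    have h2 : numO K (n + 2) = numO K (n + 1) + numA K (n + 2) := numO_succ K (by omega)
    change numA K (n + 4) ≤ numO K (n + 2)
    omega

theorem numO_pos {d : ℕ} (hd : 1 ≤ d) : 0 < numO K d := by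
  induction d, hd using Nat.le_induction with
  | base => rw [numO_one]; exact one_pos
  | succ d hd ih => rw [numO_succ K hd]; omega

end Counting

/-! ### Ratios -/

section Ratios

variable (K : Type*) [Field K]

theorem numO_lt_numO_succ {d : ℕ} (hd : 2 ≤ d) : numO K d < numO K (d + 1) := by
  have := numA_pos K (d := d + 1) (by omega)
  rw [numO_succ K (by omega)]
  omega

theorem numO_le_numO_succ {d : ℕ} (hd : 1 ≤ d) : numO K d ≤ numO K (d + 1) := by
  rw [numO_succ K hd]
  exact Nat.le_add_right _ _

theorem ratio_eq {d : ℕ} (hd : 1 ≤ d) :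
    (numO K (d + 1) : ℝ) / numO K d = 1 + (numA K (d + 1) : ℝ) / numO K d := by
  have : (0 : ℝ) < numO K d := Nat.cast_pos.2 (numO_pos K hd)
  rw [numO_succ K hd, Nat.cast_add, add_div, div_self this.ne']

theorem ratio_bounds {d : ℕ} (hd : 2 ≤ d) :
    1 < (numO K (d + 1) : ℝ) / numO K d ∧ (numO K (d + 1) : ℝ) / numO K d ≤ 2 ∧
      ((numO K (d + 1) : ℝ) / numO K d = 2 ↔ d = 2) := by
  have hpos : (0 : ℝ) < numO K d := Nat.cast_pos.2 (numO_pos K (by omega))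
  obtain ⟨n, rfl⟩ := Nat.exists_eq_add_of_le' hd
  have h1 : numO K (n + 2 + 1) = numO K (n + 2) + numA K (n + 3) := numO_succ K (by omega)
  have h2 := numA_add_three_le K n
  have h3 : numO K (n + 1) ≤ numO K (n + 2) := numO_le_numO_succ K (by omega)
  refine ⟨?_, ?_, ?_⟩
  · rw [one_lt_div hpos]
    exact_mod_cast numO_lt_numO_succ K hd
  · rw [div_le_iff₀ hpos]
    have : numO K (n + 2 + 1) ≤ 2 * numO K (n + 2) := by omega
    exact_mod_cast this
  · rw [div_eq_iff hpos.ne']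
    have key : numO K (n + 2 + 1) = 2 * numO K (n + 2) ↔ n + 2 = 2 := by
      constructor
      · intro h
        by_contra hn
        have : numO K (n + 1) < numO K (n + 2) := numO_lt_numO_succ K (by omega)
        omega
      · intro hn
        obtain rfl : n = 0 := by omega
        have hO : numO K 2 = numO K 1 + numA K 2 := numO_succ K le_rfl
        rw [numA_two, numO_one] at hO
        rw [h1, zero_add, zero_add, numA_three, hO]
    exact_mod_cast key

theorem numA_ratio_le (n : ℕ) : (numA K (n + 4) : ℝ) / numO K (n + 3) ≤
    (numA K (n + 3) : ℝ) / numO K (n + 2) + (numA K (n + 2) : ℝ) / numO K (n + 1) := by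
  have h1 : (0 : ℝ) < numO K (n + 1) := Nat.cast_pos.2 (numO_pos K (by omega))
  have h12 : (numO K (n + 1) : ℝ) ≤ numO K (n + 2) :=
    Nat.cast_le.2 (numO_le_numO_succ K (by omega))
  have h23 : (numO K (n + 2) : ℝ) ≤ numO K (n + 3) :=
    Nat.cast_le.2 (numO_le_numO_succ K (by omega))
  calc (numA K (n + 4) : ℝ) / numO K (n + 3)
      ≤ (numA K (n + 3) + numA K (n + 2)) / numO K (n + 3) := by
        gcongr
        exact_mod_cast numA_add_four_le K n
    _ = (numA K (n + 3) : ℝ) / numO K (n + 3) + (numA K (n + 2) : ℝ) / numO K (n + 3) := add_div ..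
    _ ≤ _ := by
        have h2 := h1.trans_le h12
        have h13 := h12.trans h23
        gcongr

theorem numO_ratio_le (n : ℕ) : (numO K (n + 4) : ℝ) / numO K (n + 3) ≤
    (numO K (n + 3) : ℝ) / numO K (n + 2) + (numO K (n + 2) : ℝ) / numO K (n + 1) := by
  rw [ratio_eq K (d := n + 3) (by omega), ratio_eq K (d := n + 2) (by omega),
    ratio_eq K (d := n + 1) (by omega)]
  have := numA_ratio_le K n
  linarith

theorem tendsto_numA_iff (b : ℝ) :
    Tendsto (fun d : ℕ => (numA K d : ℝ) / numO K (d - 1)) atTop (𝓝 (b - 1)) ↔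
      Tendsto (fun d : ℕ => (numO K d : ℝ) / numO K (d - 1)) atTop (𝓝 b) := by
  have h : (fun d : ℕ => (numO K d : ℝ) / numO K (d - 1)) =ᶠ[atTop]
      fun d : ℕ => (numA K d : ℝ) / numO K (d - 1) + 1 := by
    filter_upwards [eventually_ge_atTop 2] with d hd
    obtain ⟨n, rfl⟩ := Nat.exists_eq_add_of_le' (show 1 ≤ d by omega)
    rw [Nat.add_sub_cancel, ratio_eq K (by omega), add_comm]
  rw [tendsto_congr' h]
  constructor
  · intro h
    simpa using h.add_const 1
  · intro h
    simpa using h.sub_const 1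

/-- A limit `b` of the ratios satisfies `b ≤ 1 + 1 / b`, because `O_d ≤ O_{d-1} + O_{d-2}`. -/
theorem limit_le_goldenRatio {b : ℝ}
    (hb : Tendsto (fun d : ℕ => (numO K d : ℝ) / numO K (d - 1)) atTop (𝓝 b)) :
    b ≤ (1 + Real.sqrt 5) / 2 := by
  have hb₂ : Tendsto (fun n : ℕ => (numO K (n + 2) : ℝ) / numO K (n + 1)) atTop (𝓝 b) :=
    hb.comp (tendsto_add_atTop_nat 2)
  have hb₃ : Tendsto (fun n : ℕ => (numO K (n + 3) : ℝ) / numO K (n + 2)) atTop (𝓝 b) :=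
    hb.comp (tendsto_add_atTop_nat 3)
  have hpos : ∀ n, (0 : ℝ) < numO K (n + 1) := fun n => Nat.cast_pos.2 (numO_pos K (by omega))
  have h1 : 1 ≤ b := by
    refine ge_of_tendsto' hb₃ fun n => ?_
    exact (ratio_bounds K (d := n + 2) (by omega)).1.le
  have h2 : b * b ≤ b + 1 := by
    refine le_of_tendsto_of_tendsto' (hb₃.mul hb₂) (hb₂.add_const 1) fun n => ?_
    have h : numO K (n + 3) ≤ numO K (n + 2) + numO K (n + 1) := by
      rw [numO_succ K (d := n + 2) (by omega)]
      exact Nat.add_le_add_left (numA_add_three_le K n) _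
    have h' : (numO K (n + 3) : ℝ) ≤ numO K (n + 2) + numO K (n + 1) := by exact_mod_cast h
    rw [div_mul_div_cancel₀ (hpos (n + 1)).ne', div_add_one (hpos n).ne']
    exact div_le_div_of_nonneg_right h' (hpos n).le
  have h5 := Real.sq_sqrt (show (0 : ℝ) ≤ 5 by norm_num)
  have h6 := Real.sqrt_nonneg 5
  by_contra! hlt
  nlinarith

end Ratios

end OSequence

theorem proposition2p5 (K : Type*) [Field K] :
    -- bounds on the ratio; the upper bound is attained exactly at `d = 3`
    (∀ d : ℕ, 3 ≤ d →
      1 < (OSequence.numO K d : ℝ) / (OSequence.numO K (d - 1) : ℝ) ∧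
      (OSequence.numO K d : ℝ) / (OSequence.numO K (d - 1) : ℝ) ≤ 2 ∧
      ((OSequence.numO K d : ℝ) / (OSequence.numO K (d - 1) : ℝ) = 2 ↔ d = 3)) ∧
    -- the two sequences of ratios converge simultaneously, and their limits are related
    ((∃ b : ℝ, Tendsto
        (fun d : ℕ => (OSequence.numO K d : ℝ) / (OSequence.numO K (d - 1) : ℝ)) atTop (𝓝 b)) ↔
      (∃ l : ℝ, Tendsto
        (fun d : ℕ => (OSequence.numA K d : ℝ) / (OSequence.numO K (d - 1) : ℝ)) atTop (𝓝 l))) ∧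
    (∀ b l : ℝ,
      Tendsto (fun d : ℕ => (OSequence.numO K d : ℝ) / (OSequence.numO K (d - 1) : ℝ))
        atTop (𝓝 b) →
      Tendsto (fun d : ℕ => (OSequence.numA K d : ℝ) / (OSequence.numO K (d - 1) : ℝ))
        atTop (𝓝 l) →
      b = 1 + l ∧ (1 < b ↔ 0 < l)) ∧
    -- golden ratio bounds for the limits
    (∀ b : ℝ,
      Tendsto (fun d : ℕ => (OSequence.numO K d : ℝ) / (OSequence.numO K (d - 1) : ℝ))
        atTop (𝓝 b) →
      b ≤ (1 + Real.sqrt 5) / 2) ∧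
    (∀ l : ℝ,
      Tendsto (fun d : ℕ => (OSequence.numA K d : ℝ) / (OSequence.numO K (d - 1) : ℝ))
        atTop (𝓝 l) →
      l ≤ ((1 + Real.sqrt 5) / 2)⁻¹) ∧
    -- Fibonacci-type inequalities
    (∀ d : ℕ, 4 ≤ d →
      (OSequence.numA K d : ℝ) / (OSequence.numO K (d - 1) : ℝ) ≤
        (OSequence.numA K (d - 1) : ℝ) / (OSequence.numO K (d - 2) : ℝ) +
          (OSequence.numA K (d - 2) : ℝ) / (OSequence.numO K (d - 3) : ℝ) ∧
      (OSequence.numO K d : ℝ) / (OSequence.numO K (d - 1) : ℝ) ≤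
        (OSequence.numO K (d - 1) : ℝ) / (OSequence.numO K (d - 2) : ℝ) +
          (OSequence.numO K (d - 2) : ℝ) / (OSequence.numO K (d - 3) : ℝ)) := by
  refine ⟨?_, ?_, ?_, ?_, ?_, ?_⟩
  · intro d hd
    obtain ⟨n, rfl⟩ := Nat.exists_eq_add_of_le' (show 1 ≤ d by omega)
    rw [Nat.add_sub_cancel]
    obtain ⟨h1, h2, h3⟩ := OSequence.ratio_bounds K (d := n) (by omega)
    exact ⟨h1, h2, h3.trans (by omega)⟩
  · constructor
    · rintro ⟨b, hb⟩
      exact ⟨b - 1, (OSequence.tendsto_numA_iff K b).2 hb⟩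
    · rintro ⟨l, hl⟩
      exact ⟨l + 1, (OSequence.tendsto_numA_iff K _).1 (by rwa [add_sub_cancel_right])⟩
  · intro b l hb hl
    have := tendsto_nhds_unique hl ((OSequence.tendsto_numA_iff K b).2 hb)
    exact ⟨by linarith, by constructor <;> intro <;> linarith⟩
  · exact fun b hb => OSequence.limit_le_goldenRatio K hb
  · intro l hl
    have := OSequence.limit_le_goldenRatio K (b := l + 1)
      ((OSequence.tendsto_numA_iff K _).1 (by rwa [add_sub_cancel_right]))
    have h5 := Real.sq_sqrt (show (0 : ℝ) ≤ 5 by norm_num)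
    have h6 := Real.sqrt_nonneg 5
    -- the inverse of the golden ratio is the golden ratio minus one
    have hinv : ((1 + Real.sqrt 5) / 2)⁻¹ = (1 + Real.sqrt 5) / 2 - 1 := by
      rw [inv_eq_iff_eq_inv]
      refine eq_inv_of_mul_eq_one_left ?_
      nlinarith
    rw [hinv]
    linarith
  · intro d hd
    obtain ⟨n, rfl⟩ := Nat.exists_eq_add_of_le' hd
    exact ⟨OSequence.numA_ratio_le K n, OSequence.numO_ratio_le K n⟩
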